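/- **Theorem (Linear convergence of inexact proximal point iterations on nonconvex quadratic programs).** Let $\Omega\subseteq\mathbb R^n$ be a nonempty polyhedral set (the solution set of finitely many linear inequalities), let $f:\mathbb R^n\to\mathbb R$, $f(x)=\tfrac12x^\top Qx+q^\top x+c$ with $Q$ symmetric, be a (possibly nonconvex) quadratic function that is lower bounded on $\Omega$, and let $\varphi=f+\delta_\Omega$, where $\delta_\Omega(x)=0$ if $x\in\Omega$ and $\delta_\Omega(x)=\infty$ otherwise. Let $\Sigma\in\mathbb R^{n\times n}$ be symmetric positive definite, let $\|z\|_{\Sigma^{-1}}=\sqrt{\langle z,\Sigma^{-1}z\rangle}$, and let $$\operatorname{prox}_\varphi^{\Sigma}(x)=\operatorname*{argmin}_{w\in\mathbb R^n}\bigl\{\varphi(w)+\tfrac12\|w-x\|_{\Sigma^{-1}}^2\bigr\},$$ which is in general a set. Let $x^0\in\mathbb R^n$, let $(e^k)_{k\in\mathbb N}\subset\mathbb R^n$ satisfy $\|e^k\|\in O(\rho^k)$ for some $\rho\in(0,1)$, and let $(x^k)_{k\in\mathbb N}$ be any sequence starting at $x^0$ such that $$x^{k+1}\in\operatorname{prox}_\varphi^{\Sigma}(x^k+e^k)\qquad\text{for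 all }k\in\mathbb N.$$ Then $(x^k)$ converges at $R$-linear rate to a stationary point $x_\star$ of $\varphi$; that is, there are $x_\star\in\mathbb R^n$, $c'\geq0$ and $r\in(0,1)$ such that $\|x^k-x_\star\|\leq c'\,r^k$ for all $k\in\mathbb N$ and $0\in\hat\partial\varphi(x_\star)$, where, for $x$ with $\varphi(x)<\infty$, $v\in\hat\partial\varphi(x)$ means $$\liminf_{x'\to x,\;x'\neq x}\frac{\varphi(x')-\varphi(x)-\langle v,x'-x\rangle}{\|x'-x\|}\geq0.$$ -/

import Mathlib

open Filter Topology Asymptotics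
open scoped Matrix

/-- `ℝⁿ` with the Euclidean norm and inner product. -/
abbrev RVec (n : ℕ) : Type := EuclideanSpace ℝ (Fin n)

/-- The norm `‖x‖_S = √⟨x, S x⟩` induced by a positive definite matrix `S`. -/
noncomputable def weightedNorm {n : ℕ} (S : Matrix (Fin n) (Fin n) ℝ) (x : RVec n) : ℝ :=
  Real.sqrt (x.ofLp ⬝ᵥ (S *ᵥ x.ofLp))

open Classical in
/-- The indicator function of a set: `0` on the set and `∞` outside of it. -/
noncomputable def indicatorExt {n : ℕ} (Ω : Set (RVec n)) (x : RVec n) : EReal :=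
  if x ∈ Ω then 0 else ⊤

/-- A polyhedral set: the solution set of finitely many linear inequalities `A x ≤ b`. -/
def IsPolyhedralSet {n : ℕ} (Ω : Set (RVec n)) : Prop :=
  ∃ (m : ℕ) (A : Matrix (Fin m) (Fin n) ℝ) (b : Fin m → ℝ),
    Ω = {x | ∀ i, (A *ᵥ x.ofLp) i ≤ b i}

/-- A (possibly nonconvex) quadratic function `x ↦ ½ xᵀQx + qᵀx + c` with `Q` symmetric. -/
def IsQuadraticFunction {n : ℕ} (f : RVec n → ℝ) : Prop :=
  ∃ (Q : Matrix (Fin n) (Fin n) ℝ) (q : Fin n → ℝ) (c : ℝ), Q.IsSymm ∧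
    ∀ x : RVec n, f x = 1 / 2 * (x.ofLp ⬝ᵥ (Q *ᵥ x.ofLp)) + q ⬝ᵥ x.ofLp + c

/-- The proximal mapping `argmin_w { φ w + ½ ‖w - x‖²_{S⁻¹} }` with matrix stepsize `S`. -/
def proxMap {n : ℕ} (S : Matrix (Fin n) (Fin n) ℝ) (φ : RVec n → EReal) (x : RVec n) :
    Set (RVec n) :=
  {w | ∀ w' : RVec n,
    φ w + ((1 / 2 * weightedNorm S⁻¹ (w - x) ^ 2 : ℝ) : EReal) ≤
      φ w' + ((1 / 2 * weightedNorm S⁻¹ (w' - x) ^ 2 : ℝ) : EReal)}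

/-- The regular subdifferential of an extended-real-valued function
(empty at the points where the function is not finite). -/
def regularSubdifferential {n : ℕ} (φ : RVec n → EReal) (x : RVec n) : Set (RVec n) :=
  {v | φ x ≠ ⊤ ∧ φ x ≠ ⊥ ∧
    0 ≤ liminf
      (fun x' : RVec n => (φ x' - φ x - ((inner ℝ v (x' - x) : ℝ) : EReal)) / ((‖x' - x‖ : ℝ) : EReal))
      (𝓝[≠] x)}

/-- A stationary point of `φ`: the regular subdifferential of `φ` there contains `0`. -/
def IsStationaryPoint {n : ℕ} (φ : RVec n → EReal) (x : RVec n) : Prop :=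
  (0 : RVec n) ∈ regularSubdifferential φ x

/-- Convergence of a sequence to `l` at R-linear rate: the distance to `l` is bounded by a
geometric sequence with ratio in `(0, 1)`. -/
def ConvergesRLinearlyTo {n : ℕ} (x : ℕ → RVec n) (l : RVec n) : Prop :=
  ∃ (c r : ℝ), 0 < r ∧ r < 1 ∧ ∀ k, ‖x k - l‖ ≤ c * r ^ k

/-! The engine is a quadratic error bound on function values. Fix the active constraints at a point:
on that affine subspace `f` is quadratic, and a self-adjoint operator satisfies `|⟨Td, d⟩| ≤
C‖Td‖²`, so a point with residual `v` has value within `C‖v‖²` of the critical value there. With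
finitely many active sets there are finitely many such values (`exists_critical_values_polyhedron`).

A prox step decreases `f` by a multiple of the squared step length, up to an error of order
`ρ^(2k)`, so the values converge to some `a` and the residuals vanish. Finiteness forces the nearby
critical value to equal `a`, so `f (x (k+1)) - a` is bounded by the squared step plus `ρ^(2k)`.
Together with the decrease this contracts the value gap; steps are then geometric, and the
variational inequality passes to the limit. -/

section Scalar

/-! ### Scalar recursions with geometric perturbations -/

theorem geometric_bound_of_recursion {u : ℕ → ℝ} {θ B σ : ℝ} (hθ0 : 0 ≤ θ) (hθ : θ < 1)
    (hB : 0 ≤ B) (hσ0 : 0 ≤ σ) (hσ : σ < 1) (N : ℕ)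
    (hu : ∀ k, N ≤ k → u (k + 1) ≤ θ * u k + B * σ ^ k) :
    ∃ c r : ℝ, 0 ≤ c ∧ σ ≤ r ∧ 0 < r ∧ r < 1 ∧ ∀ k, N ≤ k → u k ≤ c * r ^ k := by
  -- Strict inequality `θ < r` leaves the room `c * (r - θ)` that absorbs the forcing term.
  obtain ⟨r, hr, hr1⟩ := exists_between (max_lt hθ hσ)
  have hθr : θ < r := (le_max_left _ _).trans_lt hr
  have hσr : σ < r := (le_max_right _ _).trans_lt hr
  have hr0 : 0 < r := hθ0.trans_lt hθr
  set c := max (|u N| / r ^ N) (B / (r - θ)) with hc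
  have hcB : B ≤ c * (r - θ) := by
    rw [← div_le_iff₀ (sub_pos.2 hθr)]; exact le_max_right _ _
  have hcN : u N ≤ c * r ^ N := by
    refine (le_abs_self _).trans ?_
    rw [← div_le_iff₀ (by positivity)]; exact le_max_left _ _
  refine ⟨c, r, le_max_of_le_left (by positivity), hσr.le, hr0, hr1, fun k hk => ?_⟩
  induction k, hk using Nat.le_induction with
  | base => exact hcN
  | succ k hk ih =>
    have h1 : B * σ ^ k ≤ B * r ^ k := by gcongr
    have h2 : B * r ^ k ≤ c * (r - θ) * r ^ k := by gcongr
    have h3 : θ * u k ≤ θ * (c * r ^ k) := by gcongr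
    calc u (k + 1) ≤ θ * u k + B * σ ^ k := hu k hk
      _ ≤ θ * (c * r ^ k) + c * (r - θ) * r ^ k := by linarith
      _ = c * r ^ (k + 1) := by ring

/-- Adding to `F k` the tail `B / (1 - σ) * σ ^ k` of all future perturbations gives a monotone
sequence. -/
theorem exists_limit_of_perturbed_decrease {F D : ℕ → ℝ} {α B σ : ℝ} (hα : 0 < α)
    (hσ0 : 0 ≤ σ) (hσ : σ < 1) (hD : ∀ k, 0 ≤ D k) (hB : 0 ≤ B)
    (hF : BddBelow (Set.range F)) (hdec : ∀ k, F (k + 1) + α * D k ≤ F k + B * σ ^ k) :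
    ∃ a : ℝ, Tendsto F atTop (𝓝 a) ∧ Tendsto D atTop (𝓝 0) ∧
      ∀ k, a ≤ F k + B / (1 - σ) * σ ^ k := by
  set B' := B / (1 - σ) with hB'
  have h1σ : 0 < 1 - σ := by linarith
  have hBB : B = B' * (1 - σ) := by rw [hB']; field_simp
  have hB'0 : 0 ≤ B' := by positivity
  have hG : Antitone fun k => F k + B' * σ ^ k := antitone_nat_of_succ_le fun k => by
    have := hdec k
    have h2 := mul_nonneg hα.le (hD k)
    rw [hBB] at this
    rw [pow_succ]
    linarith
  obtain ⟨b, hb⟩ := hF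
  have hGb : BddBelow (Set.range fun k => F k + B' * σ ^ k) := by
    refine ⟨b, ?_⟩
    rintro _ ⟨k, rfl⟩
    have h1 : b ≤ F k := hb ⟨k, rfl⟩
    have h2 : 0 ≤ B' * σ ^ k := by positivity
    dsimp only
    linarith
  have hσt : ∀ b : ℝ, Tendsto (fun k : ℕ => b * σ ^ k) atTop (𝓝 0) := fun b => by
    simpa using (tendsto_pow_atTop_nhds_zero_of_lt_one hσ0 hσ).const_mul b
  have hlim := tendsto_atTop_ciInf hG hGb
  set a := ⨅ k, (F k + B' * σ ^ k)
  have hFa : Tendsto F atTop (𝓝 a) := by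
    have := hlim.sub (hσt B')
    simpa using this
  refine ⟨a, hFa, ?_, fun k => ciInf_le hGb k⟩
  have hup : Tendsto (fun k => (F k - F (k + 1) + B * σ ^ k) / α) atTop (𝓝 0) := by
    have := ((hFa.sub (hFa.comp (tendsto_add_atTop_nat 1))).add (hσt B)).div_const α
    simpa using this
  refine squeeze_zero hD (fun k => ?_) hup
  rw [le_div_iff₀ hα]
  have := hdec k
  linarith

theorem geometric_steps_of_value_error_bound {F D : ℕ → ℝ} {α B σ a C : ℝ} (hα : 0 < α)
    (hσ0 : 0 ≤ σ) (hσ : σ < 1) (hB : 0 ≤ B) (hC : 0 ≤ C)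
    (hdec : ∀ k, F (k + 1) + α * D k ≤ F k + B * σ ^ k)
    (hlow : ∀ k, a ≤ F k + B / (1 - σ) * σ ^ k)
    (herr : ∀ᶠ k in atTop, F (k + 1) - a ≤ C * (D k + σ ^ k)) :
    ∃ c r : ℝ, 0 ≤ c ∧ 0 < r ∧ r < 1 ∧ ∀ᶠ k in atTop, D k ≤ c * r ^ k := by
  obtain ⟨N, hN⟩ := eventually_atTop.1 herr
  have hden : 0 < α + C := by linarith
  have hrec : ∀ k, N ≤ k → (F (k + 1) - a) ≤ C / (α + C) * (F k - a) +
      (C * (B + α) / (α + C)) * σ ^ k := fun k hk => by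
    -- Add `α` times the error bound to `C` times the decrease: `D k` cancels.
    have h1 := hN k hk
    have h2 := mul_le_mul_of_nonneg_left (hdec k) hC
    have h3 := mul_le_mul_of_nonneg_left h1 hα.le
    rw [div_mul_eq_mul_div, div_mul_eq_mul_div, ← add_div, le_div_iff₀ hden]
    nlinarith
  obtain ⟨c, r, hc, hσr, hr0, hr1, h⟩ := geometric_bound_of_recursion
    (u := fun k => F k - a) (by positivity) (by rw [div_lt_one hden]; linarith) (by positivity)
    hσ0 hσ N hrec
  have h1σ : 0 < 1 - σ := by linarith
  refine ⟨(c + B / (1 - σ) + B) / α, r, by positivity, hr0, hr1,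
    eventually_atTop.2 ⟨N, fun k hk => ?_⟩⟩
  have h1 := h k hk
  have h2 := hlow (k + 1)
  have h3 := hdec k
  have h4 : σ ^ k ≤ r ^ k := by gcongr
  have h5 : B / (1 - σ) * σ ^ (k + 1) ≤ B / (1 - σ) * r ^ k := by
    have : σ ^ (k + 1) ≤ σ ^ k := pow_le_pow_of_le_one hσ0 hσ.le (Nat.le_succ k)
    have : σ ^ (k + 1) ≤ r ^ k := this.trans h4
    gcongr
  have h6 : B * σ ^ k ≤ B * r ^ k := by gcongr
  rw [div_mul_eq_mul_div, le_div_iff₀ hα]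
  linarith

end Scalar

/-! ### Quadratic functions and their critical values on polyhedra -/

section Quadratic

variable {E : Type*} [NormedAddCommGroup E] [InnerProductSpace ℝ E]

/-- The quadratic function `x ↦ ½⟨Qx, x⟩ + ⟨q, x⟩ + c`. -/
noncomputable def quadraticFun (Q : E →L[ℝ] E) (q : E) (c : ℝ) (x : E) : ℝ :=
  1 / 2 * inner ℝ (Q x) x + inner ℝ q x + c

theorem quadraticFun_add {Q : E →L[ℝ] E} (hQ : ∀ x y, inner ℝ (Q x) y = inner ℝ x (Q y))
    (q : E) (c : ℝ) (x u : E) :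
    quadraticFun Q q c (x + u) =
      quadraticFun Q q c x + inner ℝ (Q x + q) u + 1 / 2 * inner ℝ (Q u) u := by
  have h : inner ℝ (Q u) x = inner ℝ (Q x) u := by rw [hQ, real_inner_comm]
  simp only [quadraticFun, map_add, inner_add_left, inner_add_right, h]
  ring

theorem abs_inner_apply_self_le (Q : E →L[ℝ] E) (u : E) :
    |inner ℝ (Q u) u| ≤ ‖Q‖ * ‖u‖ ^ 2 := by
  calc |inner ℝ (Q u) u| ≤ ‖Q u‖ * ‖u‖ := abs_real_inner_le_norm _ _
    _ ≤ ‖Q‖ * ‖u‖ * ‖u‖ := by gcongr; exact Q.le_opNorm u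
    _ = ‖Q‖ * ‖u‖ ^ 2 := by ring

/-- By symmetry `⟨Td, d⟩` depends only on `Td`, so `d` may be replaced by a preimage of `Td` chosen
linearly, hence of norm at most a multiple of `‖T d‖`. -/
theorem exists_abs_inner_le_sq_norm_apply [FiniteDimensional ℝ E] {T : E →L[ℝ] E}
    (hT : ∀ x y, inner ℝ (T x) y = inner ℝ x (T y)) :
    ∃ C : ℝ, 0 ≤ C ∧ ∀ d, |inner ℝ (T d) d| ≤ C * ‖T d‖ ^ 2 := by
  obtain ⟨g, hg⟩ := (T : E →ₗ[ℝ] E).rangeRestrict.exists_rightInverse_of_surjective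
    (LinearMap.range_rangeRestrict _)
  let G : LinearMap.range (T : E →ₗ[ℝ] E) →L[ℝ] E := LinearMap.toContinuousLinearMap g
  refine ⟨‖G‖, G.opNorm_nonneg, fun d => ?_⟩
  let y : LinearMap.range (T : E →ₗ[ℝ] E) := ⟨T d, d, rfl⟩
  have hTG : T (G y) = T d := congrArg Subtype.val (LinearMap.congr_fun hg y)
  have h0 : inner ℝ (T d) d = inner ℝ (T d) (G y) := by
    rw [hT d (G y), hTG, ← hT]
  rw [h0]
  calc |inner ℝ (T d) (G y)| ≤ ‖T d‖ * ‖G y‖ := abs_real_inner_le_norm _ _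
    _ ≤ ‖T d‖ * (‖G‖ * ‖T d‖) := by gcongr; exact G.le_opNorm y
    _ = ‖G‖ * ‖T d‖ ^ 2 := by ring

/-- On an affine subspace, the values of a quadratic function at points with small restricted
gradient are quadratically close to a single value. -/
theorem exists_critical_value_affine [FiniteDimensional ℝ E] {Q : E →L[ℝ] E}
    (hQ : ∀ x y, inner ℝ (Q x) y = inner ℝ x (Q y)) (q : E) (c : ℝ) (W : Submodule ℝ E) (x₀ : E) :
    ∃ a C ε : ℝ, 0 ≤ C ∧ 0 < ε ∧ ∀ x v : E, x - x₀ ∈ W →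
      (∀ w ∈ W, inner ℝ (Q x + q - v) w = 0) → ‖v‖ < ε →
      |quadraticFun Q q c x - a| ≤ C * ‖v‖ ^ 2 := by
  let P : E →L[ℝ] E := W.starProjection
  have hP : ∀ x y, inner ℝ (P x) y = inner ℝ x (P y) := W.inner_starProjection_left_eq_right
  have hPW : ∀ w ∈ W, P w = w := fun w hw => W.starProjection_eq_self_iff.2 hw
  have hPm : ∀ w, P w ∈ W := W.starProjection_apply_mem
  have hPn : ∀ w, ‖P w‖ ≤ ‖w‖ := W.norm_starProjection_apply_le
  let T : E →L[ℝ] E := P ∘L Q ∘L P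
  have hT : ∀ x y, inner ℝ (T x) y = inner ℝ x (T y) := fun x y => by
    simp only [T, ContinuousLinearMap.comp_apply, hP, hQ]
  have hzero : ∀ y, (∀ w ∈ W, inner ℝ y w = 0) → P y = 0 := fun y hy => by
    have : inner ℝ (P y) (P y) = 0 := by rw [hP, hPW _ (hPm y)]; exact hy _ (hPm y)
    simpa using this
  obtain ⟨C, hC, hCT⟩ := exists_abs_inner_le_sq_norm_apply hT
  -- This decides whether the restricted quadratic has a critical point `xb`.
  by_cases hr : P (Q x₀ + q) ∈ LinearMap.range (T : E →ₗ[ℝ] E)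
  · obtain ⟨z, hz⟩ := hr
    replace hz : T z = P (Q x₀ + q) := hz
    set xb := x₀ - P z with hxb
    have hcrit : P (Q xb + q) = 0 := by
      have : P (Q (P z)) = P (Q x₀ + q) := hz
      simp only [hxb, map_sub, map_add] at this ⊢
      rw [this]; abel
    refine ⟨quadraticFun Q q c xb, C / 2, 1, by positivity, one_pos, fun x v hx hv _ => ?_⟩
    have hd : x - xb ∈ W := by
      have : x - xb = (x - x₀) + P z := by rw [hxb]; abel
      rw [this]; exact W.add_mem hx (hPm z)
    have hTd : T (x - xb) = P v := by
      have h1 : P (Q x + q - v) = 0 := hzero _ hv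
      have h2 : T (x - xb) = P (Q (x - xb)) := by
        simp only [T, ContinuousLinearMap.comp_apply, hPW _ hd]
      rw [h2]
      have h3 : Q (x - xb) = (Q x + q - v) - (Q xb + q) + v := by rw [map_sub]; abel
      rw [h3, map_add, map_sub, h1, hcrit]; simp
    have hval : quadraticFun Q q c x - quadraticFun Q q c xb =
        1 / 2 * inner ℝ (T (x - xb)) (x - xb) := by
      have h1 := quadraticFun_add hQ q c xb (x - xb)
      rw [add_sub_cancel] at h1
      have h2 : inner ℝ (Q xb + q) (x - xb) = 0 := by
        rw [← hPW _ hd, ← hP, hcrit, inner_zero_left]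
      have h3 : inner ℝ (T (x - xb)) (x - xb) = inner ℝ (Q (x - xb)) (x - xb) := by
        simp only [T, ContinuousLinearMap.comp_apply]
        rw [hP, hPW _ hd]
      rw [h1, h2, h3]; ring
    rw [hval, abs_mul, abs_of_pos (by norm_num : (0 : ℝ) < 1 / 2)]
    have h4 := hCT (x - xb)
    have h5 : C * ‖T (x - xb)‖ ^ 2 ≤ C * ‖v‖ ^ 2 := by rw [hTd]; gcongr; exact hPn v
    linarith
  · obtain ⟨m, hm, hne⟩ : ∃ m ∈ (LinearMap.range (T : E →ₗ[ℝ] E))ᗮ,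
        inner ℝ m (P (Q x₀ + q)) ≠ 0 := by
      by_contra! hcon
      apply hr
      rw [← Submodule.orthogonal_orthogonal (LinearMap.range (T : E →ₗ[ℝ] E)),
        Submodule.mem_orthogonal]
      exact hcon
    have hm0 : 0 < ‖m‖ := norm_pos_iff.2 fun h => hne (by rw [h, inner_zero_left])
    -- Without a critical point, the component of the gradient along `m` is constant and nonzero, so
    -- residuals stay at least this large and the claim is vacuous.
    refine ⟨0, 0, |inner ℝ m (P (Q x₀ + q))| / ‖m‖, le_rfl, by positivity,
      fun x v hx hv hlt => absurd hlt (not_lt.2 ?_)⟩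
    have hPv : P v = T (x - x₀) + P (Q x₀ + q) := by
      have h1 : P (Q x + q - v) = 0 := hzero _ hv
      have h2 : T (x - x₀) = P (Q (x - x₀)) := by
        simp only [T, ContinuousLinearMap.comp_apply, hPW _ hx]
      rw [h2, ← map_add]
      have h3 : v = Q (x - x₀) + (Q x₀ + q) - (Q x + q - v) := by rw [map_sub]; abel
      conv_lhs => rw [h3, map_sub, h1, sub_zero]
    have hin : inner ℝ m (P (Q x₀ + q)) = inner ℝ m (P v) := by
      have h0 : inner ℝ m (T (x - x₀)) = 0 := (Submodule.mem_orthogonal' _ _).1 hm _ ⟨x - x₀, rfl⟩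
      rw [hPv, inner_add_right, h0, zero_add]
    rw [div_le_iff₀ hm0, hin, mul_comm]
    calc |inner ℝ m (P v)| ≤ ‖m‖ * ‖P v‖ := abs_real_inner_le_norm _ _
      _ ≤ ‖m‖ * ‖v‖ := by gcongr; exact hPn v

/-- Near-stationary points of a quadratic function on a polyhedron have values quadratically
close to one of finitely many values. -/
theorem exists_critical_values_polyhedron [FiniteDimensional ℝ E] {ι : Type*} [Fintype ι]
    {Q : E →L[ℝ] E} (hQ : ∀ x y, inner ℝ (Q x) y = inner ℝ x (Q y)) (q : E) (c : ℝ)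
    (A : ι → E →L[ℝ] ℝ) (b : ι → ℝ) :
    ∃ (V : Set ℝ) (C ε : ℝ), V.Finite ∧ 0 ≤ C ∧ 0 < ε ∧ ∀ x v : E, (∀ i, A i x ≤ b i) →
      (∀ w, (∀ i, A i w ≤ b i) → 0 ≤ inner ℝ (Q x + q - v) (w - x)) → ‖v‖ < ε →
      ∃ a ∈ V, |quadraticFun Q q c x - a| ≤ C * ‖v‖ ^ 2 := by
  classical
  let W : Set ι → Submodule ℝ E := fun I =>
    ⨅ i ∈ I, LinearMap.ker (A i : E →ₗ[ℝ] ℝ)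
  have hW : ∀ I w, w ∈ W I ↔ ∀ i ∈ I, A i w = 0 := fun I w => by
    simp [W, Submodule.mem_iInf]
  have key : ∀ I : Set ι, ∃ a C ε : ℝ, 0 ≤ C ∧ 0 < ε ∧ ∀ x v : E, (∀ i ∈ I, A i x = b i) →
      (∀ w ∈ W I, inner ℝ (Q x + q - v) w = 0) → ‖v‖ < ε →
      |quadraticFun Q q c x - a| ≤ C * ‖v‖ ^ 2 := fun I => by
    by_cases hI : ∃ x₀, ∀ i ∈ I, A i x₀ = b i
    · obtain ⟨x₀, hx₀⟩ := hI
      obtain ⟨a, C, ε, hC, hε, h⟩ := exists_critical_value_affine hQ q c (W I) x₀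
      refine ⟨a, C, ε, hC, hε, fun x v hx => h x v ?_⟩
      rw [hW]
      intro i hi
      rw [map_sub, hx i hi, hx₀ i hi, sub_self]
    · exact ⟨0, 0, 1, le_rfl, one_pos, fun x _ hx => absurd ⟨x, hx⟩ hI⟩
  choose a C ε hC hε h using key
  obtain ⟨ε₀, hε₀, hle⟩ : ∃ ε₀ > 0, ∀ I, ε₀ ≤ ε I := by
    refine ⟨Finset.univ.inf' Finset.univ_nonempty ε, ?_, fun I =>
      Finset.inf'_le _ (Finset.mem_univ I)⟩
    simp [Finset.lt_inf'_iff, hε]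
  refine ⟨Set.range a, ∑ I, C I, ε₀, Set.finite_range a, Finset.sum_nonneg fun I _ => hC I, hε₀,
    fun x v hx hVI hv => ?_⟩
  let I : Set ι := {i | A i x = b i}
  refine ⟨a I, ⟨I, rfl⟩, (h I x v (fun i hi => hi) (fun w hw => ?_) (hv.trans_le (hle I))).trans ?_⟩
  · rw [hW] at hw
    -- Inactive constraints survive small moves, so both `w` and `-w` are feasible directions.
    have hfeas : ∀ u : E, (∀ i ∈ I, A i u = 0) → 0 ≤ inner ℝ (Q x + q - v) u := fun u hu => by
      have hev : ∀ᶠ t : ℝ in 𝓝[>] 0, ∀ i, A i (x + t • u) ≤ b i := by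
        rw [eventually_all]
        intro i
        by_cases hi : A i x = b i
        · refine Eventually.of_forall fun t => ?_
          rw [map_add, map_smul, hu i hi, smul_zero, add_zero]
          exact hx i
        · have hlt : A i (x + (0 : ℝ) • u) < b i := by
            rw [zero_smul, add_zero]; exact lt_of_le_of_ne (hx i) hi
          have hct : Continuous fun t : ℝ => A i (x + t • u) := by fun_prop
          exact nhdsWithin_le_nhds
            ((hct.continuousAt.eventually_lt continuousAt_const hlt).mono fun _ h => h.le)
      obtain ⟨t, ht, ht0⟩ := (hev.and self_mem_nhdsWithin).exists
      have := hVI _ ht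
      rw [add_sub_cancel_left, inner_smul_right] at this
      exact nonneg_of_mul_nonneg_right this ht0
    have h1 := hfeas w hw
    have h2 := hfeas (-w) fun i hi => by rw [map_neg, hw i hi, neg_zero]
    rw [inner_neg_right] at h2
    linarith
  · gcongr
    exact Finset.single_le_sum (fun I _ => hC I) (Finset.mem_univ I)

/-! ### Proximal steps and convergence of the iteration -/

/-- First-order optimality of an exact proximal step over a convex set. -/
theorem variational_inequality_of_prox {Q h : E →L[ℝ] E}
    (hQ : ∀ x y, inner ℝ (Q x) y = inner ℝ x (Q y)) (hh : ∀ x y, inner ℝ (h x) y = inner ℝ x (h y))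
    (q : E) (c : ℝ) {Ω : Set E} (hΩ : Convex ℝ Ω) {y z : E} (hz : z ∈ Ω)
    (hmin : ∀ w ∈ Ω, quadraticFun Q q c z + 1 / 2 * inner ℝ (h (z - y)) (z - y) ≤
      quadraticFun Q q c w + 1 / 2 * inner ℝ (h (w - y)) (w - y)) {w : E} (hw : w ∈ Ω) :
    0 ≤ inner ℝ (Q z + q - (-h (z - y))) (w - z) := by
  set u := w - z with hu
  set g := inner ℝ (Q z + q - (-h (z - y))) u
  set K := 1 / 2 * (inner ℝ (Q u) u + inner ℝ (h u) u)
  have hev : ∀ᶠ t : ℝ in 𝓝[>] 0, 0 ≤ g + t * K := by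
    filter_upwards [Ioo_mem_nhdsGT (zero_lt_one (α := ℝ))] with t ht
    have hmem : z + t • u ∈ Ω := hΩ.add_smul_sub_mem hz hw ⟨ht.1.le, ht.2.le⟩
    have h1 := hmin _ hmem
    have h2 := quadraticFun_add hQ q c z (t • u)
    have h3 : z + t • u - y = (z - y) + t • u := by abel
    have h4 : inner ℝ (h u) (z - y) = inner ℝ (h (z - y)) u := by rw [hh, real_inner_comm]
    have h5 : 0 ≤ t * (g + t * K) := by
      rw [h2, h3] at h1
      simp only [map_add, map_smul, inner_add_left, inner_add_right, inner_smul_left,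
        inner_smul_right, h4, conj_trivial] at h1
      simp only [g, K, sub_neg_eq_add, inner_add_left]
      nlinarith
    exact nonneg_of_mul_nonneg_right h5 ht.1
  have hlim : Tendsto (fun t : ℝ => g + t * K) (𝓝[>] 0) (𝓝 g) := by
    have : Continuous fun t : ℝ => g + t * K := by fun_prop
    simpa using this.continuousWithinAt (s := Set.Ioi 0) (x := 0) |>.tendsto
  exact ge_of_tendsto hlim hev

/-- Inexact proximal point iterations on a quadratic program converge R-linearly to a point
satisfying the first-order variational inequality. -/
theorem inexact_prox_converges [FiniteDimensional ℝ E] {ι : Type*} [Fintype ι]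
    {Q h : E →L[ℝ] E} (hQ : ∀ x y, inner ℝ (Q x) y = inner ℝ x (Q y))
    (hh : ∀ x y, inner ℝ (h x) y = inner ℝ x (h y)) {m : ℝ} (hm : 0 < m)
    (hcoer : ∀ x, m * ‖x‖ ^ 2 ≤ inner ℝ (h x) x) (q : E) (c : ℝ)
    (A : ι → E →L[ℝ] ℝ) (b : ι → ℝ)
    (hbdd : BddBelow (quadraticFun Q q c '' {x | ∀ i, A i x ≤ b i}))
    {ρ M : ℝ} (hρ0 : 0 < ρ) (hρ1 : ρ < 1) {e x : ℕ → E} (he : ∀ k, ‖e k‖ ≤ M * ρ ^ k)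
    (hx : ∀ k i, A i (x k) ≤ b i)
    (hmin : ∀ k w, (∀ i, A i w ≤ b i) →
      quadraticFun Q q c (x (k + 1)) +
          1 / 2 * inner ℝ (h (x (k + 1) - (x k + e k))) (x (k + 1) - (x k + e k)) ≤
        quadraticFun Q q c w + 1 / 2 * inner ℝ (h (w - (x k + e k))) (w - (x k + e k))) :
    ∃ (l : E) (C r : ℝ), 0 < r ∧ r < 1 ∧ (∀ᶠ k in atTop, ‖x k - l‖ ≤ C * r ^ k) ∧
      (∀ i, A i l ≤ b i) ∧ ∀ w, (∀ i, A i w ≤ b i) → 0 ≤ inner ℝ (Q l + q) (w - l) := by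
  set Ω : Set E := {x | ∀ i, A i x ≤ b i} with hΩ
  have hconv : Convex ℝ Ω := by
    have : Ω = ⋂ i, {x | A i x ≤ b i} := by ext; simp [hΩ]
    rw [this]
    exact convex_iInter fun i => convex_halfSpace_le (A i).toLinearMap.isLinear (b i)
  have hM : 0 ≤ M := by simpa using (norm_nonneg _).trans (he 0)
  set v : ℕ → E := fun k => -h (x (k + 1) - (x k + e k)) with hv
  have hVI : ∀ k, ∀ w ∈ Ω, 0 ≤ inner ℝ (Q (x (k + 1)) + q - v k) (w - x (k + 1)) :=
    fun k w hw => variational_inequality_of_prox hQ hh q c hconv (hx (k + 1)) (hmin k) hw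
  set F : ℕ → ℝ := fun k => quadraticFun Q q c (x k) with hF
  set D : ℕ → ℝ := fun k => ‖x (k + 1) - x k‖ ^ 2 with hD
  -- The errors enter the decrease estimate squared.
  set σ := ρ ^ 2 with hσ
  have hσ0 : 0 ≤ σ := by positivity
  have hσ1 : σ < 1 := pow_lt_one₀ hρ0.le hρ1 two_ne_zero
  have he2 : ∀ k, ‖e k‖ ^ 2 ≤ M ^ 2 * σ ^ k := fun k => by
    calc ‖e k‖ ^ 2 ≤ (M * ρ ^ k) ^ 2 := by gcongr; exact he k
      _ = M ^ 2 * σ ^ k := by rw [hσ]; ring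
  have hdec : ∀ k, F (k + 1) + m / 4 * D k ≤ F k + ((m + ‖h‖) / 2 * M ^ 2) * σ ^ k := fun k => by
    have h1 := hmin k (x k) (hx k)
    have h2 := hcoer (x (k + 1) - (x k + e k))
    have h3 : inner ℝ (h (x k - (x k + e k))) (x k - (x k + e k)) ≤ ‖h‖ * ‖e k‖ ^ 2 := by
      have := (le_abs_self _).trans (abs_inner_apply_self_le h (x k - (x k + e k)))
      simpa using this
    have h4 : 1 / 2 * D k - ‖e k‖ ^ 2 ≤ ‖x (k + 1) - (x k + e k)‖ ^ 2 := by
      have h5 : ‖x (k + 1) - x k‖ ≤ ‖x (k + 1) - (x k + e k)‖ + ‖e k‖ := by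
        have := norm_add_le (x (k + 1) - (x k + e k)) (e k)
        have h6 : x (k + 1) - (x k + e k) + e k = x (k + 1) - x k := by abel
        rwa [h6] at this
      have h7 : D k ≤ (‖x (k + 1) - (x k + e k)‖ + ‖e k‖) ^ 2 := by
        simp only [hD]; gcongr
      nlinarith [sq_nonneg (‖x (k + 1) - (x k + e k)‖ - ‖e k‖)]
    have h5 := mul_le_mul_of_nonneg_left h4 hm.le
    have h6 := mul_le_mul_of_nonneg_left (he2 k) (by positivity : 0 ≤ (m + ‖h‖) / 2)
    simp only [hF]
    nlinarith
  have hFb : BddBelow (Set.range F) := by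
    refine hbdd.mono ?_
    rintro _ ⟨k, rfl⟩
    exact ⟨x k, hx k, rfl⟩
  have hB0 : 0 ≤ (m + ‖h‖) / 2 * M ^ 2 := by positivity
  obtain ⟨a, hFa, hD0, hlow⟩ := exists_limit_of_perturbed_decrease (by positivity) hσ0 hσ1
    (fun k => sq_nonneg _) hB0 hFb hdec
  have hv2 : ∀ k, ‖v k‖ ^ 2 ≤ 2 * ‖h‖ ^ 2 * (D k + M ^ 2 * σ ^ k) := fun k => by
    have h1 : ‖v k‖ ≤ ‖h‖ * (‖x (k + 1) - x k‖ + ‖e k‖) := by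
      simp only [hv, norm_neg]
      refine (h.le_opNorm _).trans ?_
      gcongr
      rw [← sub_sub]
      exact norm_sub_le _ _
    calc ‖v k‖ ^ 2 ≤ (‖h‖ * (‖x (k + 1) - x k‖ + ‖e k‖)) ^ 2 := by gcongr
      _ = ‖h‖ ^ 2 * (‖x (k + 1) - x k‖ + ‖e k‖) ^ 2 := by ring
      _ ≤ ‖h‖ ^ 2 * (2 * (‖x (k + 1) - x k‖ ^ 2 + ‖e k‖ ^ 2)) := by gcongr; exact add_sq_le
      _ = 2 * ‖h‖ ^ 2 * (D k + ‖e k‖ ^ 2) := by simp only [hD]; ring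
      _ ≤ 2 * ‖h‖ ^ 2 * (D k + M ^ 2 * σ ^ k) := by gcongr; exact he2 k
  have hvsq : Tendsto (fun k => ‖v k‖ ^ 2) atTop (𝓝 0) := by
    refine squeeze_zero (fun k => sq_nonneg _) hv2 ?_
    simpa using (hD0.add ((tendsto_pow_atTop_nhds_zero_of_lt_one hσ0 hσ1).const_mul
      (M ^ 2))).const_mul (2 * ‖h‖ ^ 2)
  have hv0 : Tendsto (fun k => ‖v k‖) atTop (𝓝 0) := by
    have := (Real.continuous_sqrt.tendsto 0).comp hvsq
    simpa [Function.comp_def, Real.sqrt_sq (norm_nonneg _)] using this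
  obtain ⟨V, C, ε, hV, hC, hε, hcrit⟩ := exists_critical_values_polyhedron hQ q c A b
  have hval : ∀ᶠ k in atTop, |F (k + 1) - a| ≤ C * ‖v k‖ ^ 2 := by
    have hF1 : Tendsto (fun k => |F (k + 1) - a| + C * ‖v k‖ ^ 2) atTop (𝓝 0) := by
      have := ((hFa.comp (tendsto_add_atTop_nat 1)).sub_const a).abs.add (hvsq.const_mul C)
      simpa [Function.comp_def] using this
    -- `V` is finite, so its points other than `a` stay away from `a`.
    obtain ⟨δ, hδ, hsep⟩ : ∃ δ > 0, ∀ a' ∈ V, |a' - a| < δ → a' = a := by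
      have hcl : IsClosed (V \ {a}) := (hV.subset Set.sdiff_subset).isClosed
      have : (V \ {a})ᶜ ∈ 𝓝 a := hcl.isOpen_compl.mem_nhds (by simp)
      obtain ⟨δ, hδ, hball⟩ := Metric.mem_nhds_iff.1 this
      refine ⟨δ, hδ, fun a' ha' hlt => ?_⟩
      by_contra hne
      exact hball (show a' ∈ Metric.ball a δ from hlt) ⟨ha', hne⟩
    filter_upwards [hF1.eventually_lt_const hδ, hv0.eventually_lt_const hε] with k h1 h2
    obtain ⟨a', ha', hle⟩ := hcrit (x (k + 1)) (v k) (hx (k + 1)) (hVI k) h2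
    have heq : a' = a := hsep a' ha' <| by
      have h3 : |a' - a| ≤ |F (k + 1) - a'| + |F (k + 1) - a| := by
        rw [abs_sub_comm (F (k + 1)) a']; exact abs_sub_le _ _ _
      have h4 : |F (k + 1) - a'| ≤ C * ‖v k‖ ^ 2 := hle
      linarith
    rw [← heq]; exact hle
  have herr : ∀ᶠ k in atTop, F (k + 1) - a ≤ (C * (2 * ‖h‖ ^ 2) * (1 + M ^ 2)) * (D k + σ ^ k) := by
    filter_upwards [hval] with k hk
    have h1 : 0 ≤ D k := sq_nonneg _
    have h2 : 0 ≤ σ ^ k := by positivity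
    have h3 : D k + M ^ 2 * σ ^ k ≤ (1 + M ^ 2) * (D k + σ ^ k) := by nlinarith [sq_nonneg M]
    calc F (k + 1) - a ≤ C * ‖v k‖ ^ 2 := (le_abs_self _).trans hk
      _ ≤ C * (2 * ‖h‖ ^ 2 * (D k + M ^ 2 * σ ^ k)) := by gcongr; exact hv2 k
      _ ≤ C * (2 * ‖h‖ ^ 2 * ((1 + M ^ 2) * (D k + σ ^ k))) := by gcongr
      _ = _ := by ring
  obtain ⟨c', r, hc', hr0, hr1, hgeo⟩ := geometric_steps_of_value_error_bound (by positivity)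
    hσ0 hσ1 hB0 (by positivity) hdec hlow herr
  obtain ⟨N, hN⟩ := eventually_atTop.1 hgeo
  -- `D` holds squared step lengths, hence the rate `√r` for the iterates.
  have hs1 : √r < 1 := by rw [Real.sqrt_lt' one_pos]; simpa using hr1
  have hs0 : 0 < √r := Real.sqrt_pos.2 hr0
  have hstep : ∀ k, dist (x (k + N)) (x (k + 1 + N)) ≤ (√c' * √r ^ N) * √r ^ k := fun k => by
    have h1 := hN (k + N) (Nat.le_add_left _ _)
    rw [dist_comm, dist_eq_norm, mul_assoc, ← pow_add, add_comm N k, show k + 1 + N = k + N + 1 by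
      omega]
    refine le_of_sq_le_sq ?_ (by positivity)
    rw [mul_pow, ← pow_mul, mul_comm (k + N) 2, pow_mul, Real.sq_sqrt hc', Real.sq_sqrt hr0.le]
    exact h1
  obtain ⟨l, hl⟩ := cauchySeq_tendsto_of_complete
    (cauchySeq_of_le_geometric (f := fun k => x (k + N)) _ _ hs1 hstep)
  have hxl : Tendsto x atTop (𝓝 l) := (tendsto_add_atTop_iff_nat N).1 hl
  have hxl1 : Tendsto (fun k => x (k + 1)) atTop (𝓝 l) := hxl.comp (tendsto_add_atTop_nat 1)
  refine ⟨l, √c' / (1 - √r), √r, hs0, hs1, ?_, fun i => ?_, fun w hw => ?_⟩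
  · refine eventually_atTop.2 ⟨N, fun k hk => ?_⟩
    obtain ⟨j, rfl⟩ := Nat.exists_eq_add_of_le' hk
    have := dist_le_of_le_geometric_of_tendsto (f := fun k => x (k + N)) _ _ hs1 hstep hl j
    rw [dist_eq_norm] at this
    refine this.trans (le_of_eq ?_)
    rw [pow_add]; ring
  · exact le_of_tendsto' (((A i).continuous.tendsto l).comp hxl) fun k => hx k i
  · have hvl : Tendsto v atTop (𝓝 0) := tendsto_zero_iff_norm_tendsto_zero.2 hv0
    have hlim : Tendsto (fun k => inner ℝ (Q (x (k + 1)) + q - v k) (w - x (k + 1))) atTop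
        (𝓝 (inner ℝ (Q l + q - 0) (w - l))) :=
      (((((Q.continuous.tendsto l).comp hxl1).add_const q).sub hvl).inner
        (hxl1.const_sub w))
    rw [sub_zero] at hlim
    exact ge_of_tendsto' hlim fun k => hVI k w hw

end Quadratic

/-! ### Translation to matrices and extended-real-valued functions -/

theorem inner_toEuclideanCLM {n : ℕ} (M : Matrix (Fin n) (Fin n) ℝ) (x y : RVec n) :
    inner ℝ (Matrix.toEuclideanCLM (𝕜 := ℝ) M x) y = y.ofLp ⬝ᵥ (M *ᵥ x.ofLp) := by
  simp [EuclideanSpace.inner_eq_star_dotProduct]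

theorem inner_toEuclideanCLM_comm {n : ℕ} {M : Matrix (Fin n) (Fin n) ℝ} (hM : M.IsSymm)
    (x y : RVec n) :
    inner ℝ (Matrix.toEuclideanCLM (𝕜 := ℝ) M x) y =
      inner ℝ x (Matrix.toEuclideanCLM (𝕜 := ℝ) M y) := by
  rw [← real_inner_comm x, inner_toEuclideanCLM, inner_toEuclideanCLM, Matrix.dotProduct_mulVec,
    ← Matrix.mulVec_transpose, hM.eq, dotProduct_comm]

theorem weightedNorm_sq {n : ℕ} {M : Matrix (Fin n) (Fin n) ℝ} (hM : M.PosDef) (x : RVec n) :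
    weightedNorm M x ^ 2 = inner ℝ (Matrix.toEuclideanCLM (𝕜 := ℝ) M x) x := by
  rw [weightedNorm, Real.sq_sqrt, inner_toEuclideanCLM]
  simpa using hM.posSemidef.dotProduct_mulVec_nonneg x.ofLp

theorem exists_coercive_of_pos {E : Type*} [NormedAddCommGroup E] [InnerProductSpace ℝ E]
    [FiniteDimensional ℝ E] (h : E →L[ℝ] E) (hpos : ∀ x, x ≠ 0 → 0 < inner ℝ (h x) x) :
    ∃ m : ℝ, 0 < m ∧ ∀ x, m * ‖x‖ ^ 2 ≤ inner ℝ (h x) x := by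
  obtain hE | hE := (Metric.sphere (0 : E) 1).eq_empty_or_nonempty
  · refine ⟨1, one_pos, fun x => ?_⟩
    have hx : x = 0 := by
      by_contra hx
      have : ‖x‖⁻¹ • x ∈ Metric.sphere (0 : E) 1 := by simp [norm_smul, hx]
      simp [hE] at this
    simp [hx]
  · have hc : Continuous fun x : E => inner ℝ (h x) x := by fun_prop
    obtain ⟨x₀, hx₀, hmin⟩ := (isCompact_sphere (0 : E) 1).exists_isMinOn hE hc.continuousOn
    refine ⟨inner ℝ (h x₀) x₀, hpos x₀ (ne_zero_of_mem_unit_sphere ⟨x₀, hx₀⟩), fun x => ?_⟩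
    by_cases hx : x = 0
    · simp [hx]
    · have hx' : 0 < ‖x‖ := norm_pos_iff.2 hx
      have h1 : inner ℝ (h x₀) x₀ ≤ inner ℝ (h (‖x‖⁻¹ • x)) (‖x‖⁻¹ • x) :=
        hmin (by simp [norm_smul, hx])
      rw [map_smul, inner_smul_left, inner_smul_right, conj_trivial, ← mul_assoc, ← mul_inv,
        inv_mul_eq_div, le_div_iff₀ (by positivity)] at h1
      rwa [sq]

/-- Expanding at `l` bounds the difference quotient below by `-(‖Q‖ / 2) * ‖w - l‖` on `Ω`; off `Ω`
it is `⊤`. -/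
theorem isStationaryPoint_of_variational_inequality {n : ℕ} {Q : RVec n →L[ℝ] RVec n}
    (hQ : ∀ x y, inner ℝ (Q x) y = inner ℝ x (Q y)) (q : RVec n) (c : ℝ) {Ω : Set (RVec n)}
    {φ : RVec n → EReal} (hφ : ∀ x, φ x = (quadraticFun Q q c x : EReal) + indicatorExt Ω x)
    {l : RVec n} (hl : l ∈ Ω) (hVI : ∀ w ∈ Ω, 0 ≤ inner ℝ (Q l + q) (w - l)) :
    IsStationaryPoint φ l := by
  have hφl : φ l = (quadraticFun Q q c l : EReal) := by rw [hφ, indicatorExt, if_pos hl, add_zero]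
  refine ⟨by rw [hφl]; exact EReal.coe_ne_top _, by rw [hφl]; exact EReal.coe_ne_bot _, ?_⟩
  have hlim : Tendsto (fun w : RVec n => ((-(‖Q‖ / 2 * ‖w - l‖) : ℝ) : EReal)) (𝓝[≠] l) (𝓝 0) := by
    have hc : Continuous fun w : RVec n => -(‖Q‖ / 2 * ‖w - l‖) := by fun_prop
    have h0 : Tendsto (fun w : RVec n => -(‖Q‖ / 2 * ‖w - l‖)) (𝓝[≠] l) (𝓝 0) := by
      simpa using (hc.tendsto l).mono_left nhdsWithin_le_nhds
    exact (continuous_coe_real_ereal.tendsto 0).comp h0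
  -- The punctured filter is trivial when `n = 0`.
  obtain hbot | hne := (𝓝[≠] l).eq_or_neBot
  · rw [hbot]; simp
  rw [← hlim.liminf_eq]
  refine liminf_le_liminf (eventually_mem_nhdsWithin.mono fun w hw => ?_)
  have hw0 : 0 < ‖w - l‖ := norm_pos_iff.2 (sub_ne_zero.2 hw)
  rw [hφl, inner_zero_left, hφ, indicatorExt]
  split_ifs with hmem
  · rw [add_zero, ← EReal.coe_sub, ← EReal.coe_sub, ← EReal.coe_div, EReal.coe_le_coe_iff, sub_zero,
      le_div_iff₀ hw0]
    have h1 := quadraticFun_add hQ q c l (w - l)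
    rw [add_sub_cancel] at h1
    have h2 := (abs_le.1 (abs_inner_apply_self_le Q (w - l))).1
    have h3 := hVI w hmem
    rw [h1]
    nlinarith
  · rw [EReal.coe_add_top, EReal.top_sub_coe, EReal.top_sub_coe,
      EReal.top_div_of_pos_ne_top (by exact_mod_cast hw0) (EReal.coe_ne_top _)]
    exact le_top

theorem mem_and_minimizes_of_mem_proxMap {n : ℕ} {S : Matrix (Fin n) (Fin n) ℝ} {f : RVec n → ℝ}
    {Ω : Set (RVec n)} (hΩ : Ω.Nonempty) {φ : RVec n → EReal}
    (hφ : ∀ x, φ x = (f x : EReal) + indicatorExt Ω x) {y z : RVec n} (hz : z ∈ proxMap S φ y) :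
    z ∈ Ω ∧ ∀ w ∈ Ω, f z + 1 / 2 * weightedNorm S⁻¹ (z - y) ^ 2 ≤
      f w + 1 / 2 * weightedNorm S⁻¹ (w - y) ^ 2 := by
  have hin : ∀ w ∈ Ω, φ w = (f w : EReal) := fun w hw => by
    rw [hφ, indicatorExt, if_pos hw, add_zero]
  have hzΩ : z ∈ Ω := by
    by_contra hzn
    obtain ⟨w, hw⟩ := hΩ
    have := hz w
    rw [hin w hw, hφ, indicatorExt, if_neg hzn, EReal.coe_add_top, EReal.top_add_coe,
      ← EReal.coe_add, top_le_iff] at this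
    exact EReal.coe_ne_top _ this
  refine ⟨hzΩ, fun w hw => ?_⟩
  have := hz w
  rw [hin z hzΩ, hin w hw] at this
  exact_mod_cast this

theorem convergesRLinearlyTo_of_eventually {n : ℕ} {x : ℕ → RVec n} {l : RVec n} {c r : ℝ}
    (hr0 : 0 < r) (hr1 : r < 1) (h : ∀ᶠ k in atTop, ‖x k - l‖ ≤ c * r ^ k) :
    ConvergesRLinearlyTo x l := by
  have hO : (fun k => x k - l) =O[atTop] fun k : ℕ => r ^ k := by
    refine IsBigO.of_bound c (h.mono fun k hk => ?_)
    rwa [Real.norm_of_nonneg (by positivity)]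
  obtain ⟨C, -, hC⟩ := bound_of_isBigO_nat_atTop hO
  refine ⟨C, r, hr0, hr1, fun k => ?_⟩
  have := hC (x := k) (by positivity)
  rwa [Real.norm_of_nonneg (by positivity)] at this

theorem mainTheorem2 (n : ℕ) (Ω : Set (RVec n)) (hΩne : Ω.Nonempty) (hΩ : IsPolyhedralSet Ω)
    (f : RVec n → ℝ) (hf : IsQuadraticFunction f) (hbdd : BddBelow (f '' Ω))
    (φ : RVec n → EReal) (hφ : ∀ x, φ x = (f x : EReal) + indicatorExt Ω x)
    (S : Matrix (Fin n) (Fin n) ℝ) (hS : S.PosDef)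
    (ρ : ℝ) (hρ0 : 0 < ρ) (hρ1 : ρ < 1)
    (e : ℕ → RVec n) (he : e =O[atTop] fun k : ℕ => ρ ^ k)
    (x : ℕ → RVec n) (hx : ∀ k, x (k + 1) ∈ proxMap S φ (x k + e k)) :
    ∃ xstar : RVec n, IsStationaryPoint φ xstar ∧ ConvergesRLinearlyTo x xstar := by
  obtain ⟨p, A, b, rfl⟩ := hΩ
  obtain ⟨Q, q, c, hQ, hfQ⟩ := hf
  have hQs := inner_toEuclideanCLM_comm hQ
  have hSi : S⁻¹.PosDef := hS.inv
  have hSs : S⁻¹.IsSymm := by simpa using hSi.isHermitian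
  have hhs := inner_toEuclideanCLM_comm hSs
  obtain ⟨m, hm, hcoer⟩ := exists_coercive_of_pos (Matrix.toEuclideanCLM (𝕜 := ℝ) S⁻¹)
    fun x hx0 => by
      rw [inner_toEuclideanCLM]
      have hx1 : x.ofLp ≠ 0 := fun h0 => hx0 (WithLp.ofLp_injective 2 h0)
      simpa using hSi.dotProduct_mulVec_pos hx1
  obtain rfl : f = quadraticFun (Matrix.toEuclideanCLM (𝕜 := ℝ) Q) (WithLp.toLp 2 q) c := by
    funext y
    rw [hfQ, quadraticFun, inner_toEuclideanCLM, EuclideanSpace.inner_eq_star_dotProduct]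
    simp [dotProduct_comm]
  let a : Fin p → RVec n →L[ℝ] ℝ := fun i => innerSL ℝ (WithLp.toLp 2 (A i))
  have ha : ∀ i (w : RVec n), a i w = (A *ᵥ w.ofLp) i := fun i w => by
    simp [a, EuclideanSpace.inner_eq_star_dotProduct, Matrix.mulVec, dotProduct_comm]
  obtain ⟨M, -, hM⟩ := bound_of_isBigO_nat_atTop he
  have hprox := fun k => mem_and_minimizes_of_mem_proxMap hΩne hφ (hx k)
  simp only [weightedNorm_sq hSi, Set.mem_ofPred_eq, ← ha] at hprox
  simp only [← ha] at hbdd hφ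
  -- Indices shift by one because `x 0` may lie outside `Ω`.
  obtain ⟨l, C, r, hr0, hr1, hlim, hlΩ, hVI⟩ := inexact_prox_converges hQs hhs hm hcoer
    (WithLp.toLp 2 q) c a b hbdd hρ0 hρ1 (e := fun k => e (k + 1)) (x := fun k => x (k + 1))
    (M := M * ρ) (fun k => by
      have := hM (x := k + 1) (by positivity)
      rw [Real.norm_of_nonneg (by positivity)] at this
      rwa [mul_assoc, ← pow_succ'])
    (fun k => (hprox k).1) (fun k => (hprox (k + 1)).2)
  refine ⟨l, isStationaryPoint_of_variational_inequality hQs _ c hφ hlΩ hVI,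
    convergesRLinearlyTo_of_eventually (c := C / r) hr0 hr1 ?_⟩
  rw [← map_add_atTop_eq_nat 1, eventually_map]
  filter_upwards [hlim] with k hk
  rw [pow_succ', ← mul_assoc, div_mul_cancel₀ _ hr0.ne']
  exact hk
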